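/- Let $R$ be any $\mathbb{Q}$-algebra. A bimould with coefficients in $R$ is a sequence $M=(M_d)_{d\ge 0}$ of power series $M_d=M_d\binom{X_1,\ldots,X_d}{Y_1,\ldots,Y_d}\in R[[X_1,Y_1,\ldots,X_d,Y_d]]$. For a bimould $M$ define bimoulds $M^{\#_Y}$, $\tau(M)$ and $\operatorname{swap}(M)$ by $$M_d^{\#_Y}\binom{X_1,\ldots,X_d}{Y_1,\ldots,Y_d}=M_d\binom{X_1,\ldots,X_d}{Y_1,\,Y_1+Y_2,\ldots,\,Y_1+\cdots+Y_d},\qquad \tau(M)_d\binom{X_1,\ldots,X_d}{Y_1,\ldots,Y_d}=M_d\binom{Y_d,\ldots,Y_1}{X_d,\ldots,X_1},$$ $$\operatorname{swap}(M)_d\binom{X_1,\ldots,X_d}{Y_1,\ldots,Y_d}=M_d\binom{Y_1+\cdots+Y_d,\,Y_1+\cdots+Y_{d-1},\ldots,\,Y_1}{X_d,\,X_{d-1}-X_d,\ldots,\,X_1-X_2}.$$ $M$ is called $\tau$-invariant if $\tau(M)=M$, and swap invariant if $\operatorname{swap}(M)=M$. Let $\mathbb{Q}\langle\mathcal{Y}^{\mathrm{bi}}\rangle$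 be the free non-commutative algebra on the letters $y_{k,m}$ ($k\ge1$, $m\ge0$), with the stuffle product $*$, that is, the bilinear product with $\mathbf 1*w=w*\mathbf 1=w$ and $$y_{k_1,m_1}u*y_{k_2,m_2}v=y_{k_1,m_1}(u*y_{k_2,m_2}v)+y_{k_2,m_2}(y_{k_1,m_1}u*v)+y_{k_1+k_2,m_1+m_2}(u*v).$$ Let $\mathbb{Q}\langle\mathcal{B}\rangle$ be the free non-commutative algebra on the letters $b_0,b_1,b_2,\ldots$, with the balanced quasi-shuffle product $*_b$, that is, the bilinear product with $\mathbf 1*_bw=w*_b\mathbf 1=w$ and $$b_iu*_bb_jv=b_i(u*_bb_jv)+b_j(b_iu*_bv)+\begin{cases}b_{i+j}(u*_bv)&\text{if } i,j\ge1,\\0&\text{else,}\end{cases}$$ and let $\mathbb{Q}\langle\mathcal{B}\rangle^0$ be the subspace spanned by the words that do not start with $b_0$; it is closed under $*_b$. $M$ is symmetril if $M_0=1$ and there is a (unital) $\mathbb{Q}$-algebra morphism $\varphi:(\mathbb{Q}\langle\mathcal{Y}^{\mathrm{bi}}\rangle,*)\to R$ such that for all $d\ge1$ $$M_d=\sum_{k_1,\ldots,k_d\ge1,\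 m_1,\ldots,m_d\ge0}\varphi(y_{k_1,m_1}\cdots y_{k_d,m_d})\,X_1^{k_1-1}\frac{Y_1^{m_1}}{m_1!}\cdots X_d^{k_d-1}\frac{Y_d^{m_d}}{m_d!}.$$ $M$ is b-symmetril if $M_0=1$ and there is a (unital) $\mathbb{Q}$-algebra morphism $\psi:(\mathbb{Q}\langle\mathcal{B}\rangle^0,*_b)\to R$ such that for all $d\ge1$ $$M_d=\sum_{k_1,\ldots,k_d\ge1,\ m_1,\ldots,m_d\ge0}\psi(b_{k_1}b_0^{m_1}\cdots b_{k_d}b_0^{m_d})\,X_1^{k_1-1}Y_1^{m_1}\cdots X_d^{k_d-1}Y_d^{m_d}.$$ Then, for every bimould $M$ with coefficients in $R$: 1. $M$ is b-symmetril if and only if $M^{\#_Y}$ is symmetril; 2. $M$ is $\tau$-invariant if and only if $M^{\#_Y}$ is swap invariant. -/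

import Mathlib

namespace BalancedQMZV

noncomputable section

/-! ## Words and quasi-shuffle products -/

/-- The free non-commutative algebra `ℚ⟨A⟩` on the alphabet `A`; its basis is the set
`FreeMonoid A` of words, its multiplication is concatenation, its `1` is the empty word. -/
abbrev NCPoly (A : Type) : Type := MonoidAlgebra ℚ (FreeMonoid A)

/-- A word, given as the list of its letters, as an element of `ℚ⟨A⟩`. -/
def word {A : Type} (w : List A) : NCPoly A := MonoidAlgebra.single (FreeMonoid.ofList w) 1

/-- A linear combination of letters as an element of `ℚ⟨A⟩`. -/
def letters {A : Type} (p : A →₀ ℚ) : NCPoly A := p.sum fun a r => r • word [a]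

/-- The quasi-shuffle product of two words, for a product `dia` on the span of the letters (given
by its values on pairs of letters):
`au * bv = a (u * bv) + b (au * v) + (a ⋄ b) (u * v)`. -/
def qshWord {A : Type} (dia : A → A → (A →₀ ℚ)) : List A → List A → NCPoly A
  | [], v => word v
  | a :: u, [] => word (a :: u)
  | a :: u, b :: v =>
      word [a] * qshWord dia u (b :: v) + word [b] * qshWord dia (a :: u) v
        + letters (dia a b) * qshWord dia u v
  termination_by u v => u.length + v.length

/-- The quasi-shuffle product on `ℚ⟨A⟩`: the bilinear extension of the product of words. -/
def qsh {A : Type} (dia : A → A → (A →₀ ℚ)) (f g : NCPoly A) : NCPoly A :=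
  f.coeff.sum fun u r => g.coeff.sum fun v s =>
    (r * s) • qshWord dia (FreeMonoid.toList u) (FreeMonoid.toList v)

/-! ## The stuffle algebra on the bi-alphabet -/

/-- The letters `y_{k,m}` with `k ≥ 1` and `m ≥ 0`. -/
abbrev Ybi : Type := ℕ+ × ℕ

/-- `y_{k₁,m₁} ⋄ y_{k₂,m₂} = y_{k₁+k₂,m₁+m₂}`. -/
def diaY (a b : Ybi) : Ybi →₀ ℚ := Finsupp.single (a.1 + b.1, a.2 + b.2) 1

/-- The stuffle product on `ℚ⟨Ybi⟩`. -/
def stuffle (f g : NCPoly Ybi) : NCPoly Ybi := qsh diaY f g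

/-! ## The balanced quasi-shuffle algebra -/

/-- The letters `b_0, b_1, b_2, …`. -/
abbrev B : Type := ℕ

/-- `b_i ⋄ b_j = b_{i+j}` if `i, j ≥ 1`, and `0` otherwise. -/
def diaB (i j : B) : B →₀ ℚ := if 1 ≤ i ∧ 1 ≤ j then Finsupp.single (i + j) 1 else 0

/-- The balanced quasi-shuffle product on `ℚ⟨B⟩`. -/
def balanced (f g : NCPoly B) : NCPoly B := qsh diaB f g

/-- The subspace `ℚ⟨B⟩⁰` spanned by the words that do not start with `b_0`
(the empty word is one of them). -/
def NCPolyB0 : Submodule ℚ (NCPoly B) :=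
  Submodule.span ℚ {f | ∃ w : List B, w.head? ≠ some 0 ∧ f = word w}

theorem word_mem_B0 {w : List B} (h : w.head? ≠ some 0) : word w ∈ NCPolyB0 :=
  Submodule.subset_span ⟨w, h, rfl⟩

theorem word_mul_word {A : Type} (u v : List A) : word u * word v = word (u ++ v) := by
  simp [word, MonoidAlgebra.single_mul_single]

theorem single_eq_smul_word {A : Type} (w : FreeMonoid A) (r : ℚ) :
    (MonoidAlgebra.single w r : NCPoly A) = r • word (FreeMonoid.toList w) := by
  simp [word]

theorem letter_mul_mem_B0 {a : B} (ha : a ≠ 0) (f : NCPoly B) : word [a] * f ∈ NCPolyB0 := by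
  induction f using MonoidAlgebra.induction_linear with
  | zero => simp
  | add f g hf hg => rw [mul_add]; exact add_mem hf hg
  | single w r =>
    rw [single_eq_smul_word, mul_smul_comm, word_mul_word]
    exact Submodule.smul_mem _ _ (word_mem_B0 (by simpa using ha))

theorem letters_diaB_mul_mem_B0 (a b : B) (f : NCPoly B) :
    letters (diaB a b) * f ∈ NCPolyB0 := by
  unfold diaB
  split_ifs with h
  · have : letters (Finsupp.single (a + b) 1) = word [a + b] := by simp [letters]
    rw [this]
    exact letter_mul_mem_B0 (Nat.pos_iff_ne_zero.1 (Nat.add_pos_left h.1 b)) f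
  · simp [letters]

theorem qshWord_mem_B0 {u v : List B} (hu : u.head? ≠ some 0) (hv : v.head? ≠ some 0) :
    qshWord diaB u v ∈ NCPolyB0 := by
  cases u with
  | nil => rw [qshWord]; exact word_mem_B0 hv
  | cons a u =>
    cases v with
    | nil => rw [qshWord]; exact word_mem_B0 hu
    | cons b v =>
      rw [qshWord]
      exact add_mem (add_mem (letter_mul_mem_B0 (by simpa using hu) _)
        (letter_mul_mem_B0 (by simpa using hv) _)) (letters_diaB_mul_mem_B0 a b _)

theorem head_of_mem_B0 {f : NCPoly B} (hf : f ∈ NCPolyB0) :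
    ∀ w ∈ f.coeff.support, (FreeMonoid.toList w).head? ≠ some 0 := by
  suffices h : ∀ w : FreeMonoid B, (FreeMonoid.toList w).head? = some 0 → f.coeff w = 0 by
    intro w hw h0
    exact (Finsupp.mem_support_iff.1 hw) (h w h0)
  intro w hw
  induction hf using Submodule.span_induction with
  | mem x hx =>
    obtain ⟨v, hv, rfl⟩ := hx
    have : FreeMonoid.ofList v ≠ w := by
      rintro rfl
      exact hv (by simpa using hw)
    simp [word, this]
  | zero => simp
  | add x y _ _ hx hy => simp [hx, hy]
  | smul r x _ hx => simp [hx]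

/-- `ℚ⟨B⟩⁰` is closed under the balanced quasi-shuffle product. -/
theorem balanced_mem_B0 {f g : NCPoly B} (hf : f ∈ NCPolyB0) (hg : g ∈ NCPolyB0) :
    balanced f g ∈ NCPolyB0 :=
  Submodule.sum_mem _ fun u hu => Submodule.sum_mem _ fun v hv =>
    Submodule.smul_mem _ _ (qshWord_mem_B0 (head_of_mem_B0 hf u hu) (head_of_mem_B0 hg v hv))

/-- The balanced quasi-shuffle product on `ℚ⟨B⟩⁰`. -/
def balanced0 (f g : NCPolyB0) : NCPolyB0 := ⟨balanced f g, balanced_mem_B0 f.2 g.2⟩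

/-- The list of letters of `b_{k₁} b₀^{m₁} ⋯ b_{k_d} b₀^{m_d}`, where `k_i = κ_i + 1`. -/
def blockWord {d : ℕ} (κ m : Fin d → ℕ) : List B :=
  (List.ofFn fun i => (κ i + 1) :: List.replicate (m i) 0).flatten

theorem blockWord_head {d : ℕ} (κ m : Fin d → ℕ) : (blockWord κ m).head? ≠ some 0 := by
  cases d with
  | zero => simp [blockWord]
  | succ d => simp [blockWord, List.ofFn_succ]

/-- The word `b_{k₁} b₀^{m₁} ⋯ b_{k_d} b₀^{m_d}`, where `k_i = κ_i + 1`, as an element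
of `ℚ⟨B⟩⁰`. -/
def wordB0 {d : ℕ} (κ m : Fin d → ℕ) : NCPolyB0 :=
  ⟨word (blockWord κ m), word_mem_B0 (blockWord_head κ m)⟩

/-- The word `y_{k₁,m₁} ⋯ y_{k_d,m_d}`, where `k_i = κ_i + 1`, as an element of `ℚ⟨Ybi⟩`. -/
def wordY {d : ℕ} (κ m : Fin d → ℕ) : NCPoly Ybi :=
  word (List.ofFn fun i => ((κ i).succPNat, m i))

/-! ## Coefficient maps -/

section CoefficientMaps

variable {R : Type*} [Ring R] [Algebra ℚ R]

/-- `φ` is a morphism of `ℚ`-algebras `(ℚ⟨Ybi⟩, *) → R` for the stuffle product. -/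
structure IsStuffleHom (φ : NCPoly Ybi →ₗ[ℚ] R) : Prop where
  map_one : φ 1 = 1
  map_mul : ∀ f g, φ (stuffle f g) = φ f * φ g

/-- `φ` is a morphism of `ℚ`-algebras `(ℚ⟨B⟩⁰, *_b) → R` for the balanced quasi-shuffle product,
whose unit is the empty word. -/
structure IsBalancedHom (φ : NCPolyB0 →ₗ[ℚ] R) : Prop where
  map_one : φ ⟨word [], word_mem_B0 (by simp)⟩ = 1
  map_mul : ∀ f g, φ (balanced0 f g) = φ f * φ g

end CoefficientMaps

/-! ## Bimoulds -/

/-- A bimould with coefficients in `R`: for each `d` a power series in `X_1, Y_1, …, X_d, Y_d`.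
The variable `X_{i+1}` is indexed by `Sum.inl i` and `Y_{i+1}` by `Sum.inr i`, for `i : Fin d`. -/
abbrev Bimould (R : Type*) : Type _ := ∀ d : ℕ, MvPowerSeries (Fin d ⊕ Fin d) R

section Substitution

/-- The substitution of polynomials `L s` with rational coefficients for the variables of a power
series `f = ∑ f_e Z^e` whose coefficient ring is any (possibly non-commutative) `ℚ`-algebra:
the coefficients of `∑ f_e L^e`. It is applied only to linear forms `L s` and finitely many
variables `s`, where each coefficient is a finite sum. -/
def substPoly {σ τ R : Type*} [Ring R] [Algebra ℚ R] (L : σ → MvPolynomial τ ℚ)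
    (f : MvPowerSeries σ R) : MvPowerSeries τ R :=
  fun n => ∑ᶠ e : σ →₀ ℕ,
    MvPolynomial.coeff n (e.prod fun s k => L s ^ k) • MvPowerSeries.coeff e f

/-- For commutative coefficients this is the substitution of power series. -/
theorem substPoly_eq_subst {σ τ R : Type*} [Finite σ] [CommRing R] [Algebra ℚ R]
    (L : σ → MvPolynomial τ ℚ) (hL : ∀ s, MvPolynomial.constantCoeff (L s) = 0)
    (f : MvPowerSeries σ R) :
    substPoly L f = MvPowerSeries.subst
      (fun s => ((MvPolynomial.map (algebraMap ℚ R) (L s) : MvPolynomial τ R) :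
        MvPowerSeries τ R)) f := by
  ext n
  rw [MvPowerSeries.coeff_subst]
  · rw [MvPowerSeries.coeff_apply, substPoly]
    refine finsum_congr fun e => ?_
    have : (e.prod fun s k => ((MvPolynomial.map (algebraMap ℚ R) (L s) : MvPolynomial τ R) :
        MvPowerSeries τ R) ^ k)
        = ((MvPolynomial.map (algebraMap ℚ R) (e.prod fun s k => L s ^ k) :
          MvPolynomial τ R) : MvPowerSeries τ R) := by
      simp only [Finsupp.prod, map_prod, map_pow]
      rw [← MvPolynomial.coeToMvPowerSeries.ringHom_apply, map_prod]
      simp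
    rw [this, MvPolynomial.coeff_coe, MvPolynomial.coeff_map, Algebra.smul_def, smul_eq_mul,
      mul_comm]
  · apply MvPowerSeries.hasSubst_of_constantCoeff_zero
    intro s
    have := hL s
    rw [MvPolynomial.constantCoeff_eq] at this
    rw [← MvPowerSeries.coeff_zero_eq_constantCoeff_apply, MvPolynomial.coeff_coe,
      MvPolynomial.coeff_map, this, map_zero]

/-- The variable `X_{i+1}`. -/
def varX {d : ℕ} (i : Fin d) : MvPolynomial (Fin d ⊕ Fin d) ℚ := MvPolynomial.X (Sum.inl i)

/-- The variable `Y_{i+1}`. -/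
def varY {d : ℕ} (i : Fin d) : MvPolynomial (Fin d ⊕ Fin d) ℚ := MvPolynomial.X (Sum.inr i)

/-- The partial sum `Y_1 + ⋯ + Y_{i+1}`. -/
def sumY {d : ℕ} (i : Fin d) : MvPolynomial (Fin d ⊕ Fin d) ℚ := ∑ j ∈ Finset.Iic i, varY j

/-- The difference `X_{d-i} - X_{d-i+1}`, where `X_{d+1}` is read as `0`: for `i = 0, 1, …, d-1`
these are `X_d, X_{d-1} - X_d, …, X_1 - X_2`. -/
def diffX {d : ℕ} (i : Fin d) : MvPolynomial (Fin d ⊕ Fin d) ℚ :=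
  varX i.rev - if h : i.val = 0 then 0 else varX ⟨d - i.val, by have := i.isLt; omega⟩

end Substitution

section Symmetries

variable {R : Type*} [Ring R] [Algebra ℚ R]

/-- `M^{#_Y}`: substitute `X_i ↦ X_i` and `Y_i ↦ Y_1 + ⋯ + Y_i`. -/
def sharpY (M : Bimould R) : Bimould R := fun d =>
  substPoly (Sum.elim varX sumY) (M d)

/-- `swap(M)_d = M_d (Y_1+⋯+Y_d, …, Y_1 ; X_d, X_{d-1}-X_d, …, X_1-X_2)`. -/
def swap (M : Bimould R) : Bimould R := fun d =>
  substPoly (Sum.elim (fun i => sumY i.rev) diffX) (M d)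

/-- `τ(M)_d = M_d (Y_d, …, Y_1 ; X_d, …, X_1)`. -/
def tau (M : Bimould R) : Bimould R := fun d =>
  substPoly (Sum.elim (fun i => varY i.rev) (fun i => varX i.rev)) (M d)

/-- `M` is swap invariant. -/
def SwapInvariant (M : Bimould R) : Prop := swap M = M

/-- `M` is `τ`-invariant. -/
def TauInvariant (M : Bimould R) : Prop := tau M = M

/-- The power series
`∑ φ(y_{k₁,m₁} ⋯ y_{k_d,m_d}) X_1^{k₁-1} Y_1^{m₁}/m₁! ⋯ X_d^{k_d-1} Y_d^{m_d}/m_d!`. -/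
def genSeriesY (φ : NCPoly Ybi →ₗ[ℚ] R) (d : ℕ) : MvPowerSeries (Fin d ⊕ Fin d) R := fun e =>
  (∏ i : Fin d, (1 / ((e (Sum.inr i)).factorial : ℚ))) •
    φ (wordY (fun i => e (Sum.inl i)) (fun i => e (Sum.inr i)))

/-- The power series
`∑ φ(b_{k₁} b₀^{m₁} ⋯ b_{k_d} b₀^{m_d}) X_1^{k₁-1} Y_1^{m₁} ⋯ X_d^{k_d-1} Y_d^{m_d}`. -/
def genSeriesB (φ : NCPolyB0 →ₗ[ℚ] R) (d : ℕ) : MvPowerSeries (Fin d ⊕ Fin d) R := fun e =>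
  φ (wordB0 (fun i => e (Sum.inl i)) (fun i => e (Sum.inr i)))

/-- `M` is symmetril. -/
def Symmetril (M : Bimould R) : Prop :=
  ∃ φ : NCPoly Ybi →ₗ[ℚ] R, IsStuffleHom φ ∧ M 0 = 1 ∧ ∀ d : ℕ, 1 ≤ d → M d = genSeriesY φ d

/-- `M` is b-symmetril. -/
def BSymmetril (M : Bimould R) : Prop :=
  ∃ φ : NCPolyB0 →ₗ[ℚ] R, IsBalancedHom φ ∧ M 0 = 1 ∧ ∀ d : ℕ, 1 ≤ d → M d = genSeriesB φ d

end Symmetries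

end

end BalancedQMZV

/-! Part 1 comes from a surjective morphism `transform0` from the stuffle algebra onto the balanced
algebra. In generating series form it sends the `y`-words with fixed `k_i` to `b_{k_1} (1 - Y_1
b_0)⁻¹ b_{k_2} (1 - (Y_1 + Y_2) b_0)⁻¹ ⋯`, so by construction `#_Y` turns the series of `ψ` into the
series of `ψ ∘ transform0` (`sharpY_genSeriesB`).

Multiplicativity becomes inductive once a parameter `t` is added to all partial sums. The resulting
series satisfy `F_t(y u) = t b_0 F_t(y u) + b_k F_{t+Y}(u)`. Since `b_0` has no diamond product with
any letter, `F_s(u) *_b F_t(v)` obeys the same recursion as `F_{s+t}(u * v)`; this is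
`qshL_transformWord`, with the powers of `s` and `t` extracted.

If `ψ` is a balanced morphism, `ψ ∘ transform0` is a stuffle morphism. Conversely, the coefficients
of `M` always define a linear `ψ`. If `#_Y M` comes from a stuffle morphism `φ`, comparing
coefficients gives `ψ ∘ transform0 = φ`, and surjectivity makes `ψ` multiplicative.

Part 2 is the intertwining relation `swap_sharpY`, together with injectivity of `#_Y`. -/

namespace BalancedQMZV

noncomputable section

open Finset

/-! ### Linear maps determined by their values on words -/

section WordLift

variable {A : Type} {V : Type*} [AddCommGroup V] [Module ℚ V]

/-- The linear map on `ℚ⟨A⟩` with prescribed values on words. -/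
def wordLift (c : List A → V) : NCPoly A →ₗ[ℚ] V :=
  Finsupp.linearCombination ℚ (fun w : FreeMonoid A => c (FreeMonoid.toList w)) ∘ₗ
    (MonoidAlgebra.coeffLinearEquiv ℚ).toLinearMap

theorem wordLift_apply (c : List A → V) (f : NCPoly A) :
    wordLift c f = f.coeff.sum fun w r => r • c (FreeMonoid.toList w) := rfl

@[simp]
theorem wordLift_word (c : List A → V) (w : List A) : wordLift c (word w) = c w := by
  simp [wordLift_apply, word]

theorem induction_word {p : NCPoly A → Prop} (f : NCPoly A) (zero : p 0)
    (add : ∀ f g, p f → p g → p (f + g)) (smul : ∀ (r : ℚ) f, p f → p (r • f))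
    (word : ∀ w : List A, p (word w)) : p f := by
  induction f using MonoidAlgebra.induction_linear with
  | zero => exact zero
  | add f g hf hg => exact add f g hf hg
  | single w r => rw [single_eq_smul_word]; exact smul _ _ (word _)

theorem ext_word {F G : NCPoly A →ₗ[ℚ] V} (h : ∀ w, F (word w) = G (word w)) : F = G := by
  refine LinearMap.ext fun f => ?_
  induction f using induction_word with
  | zero => simp
  | add f g hf hg => simp [hf, hg]
  | smul r f hf => simp [hf]
  | word w => exact h w

theorem word_nil : word ([] : List A) = 1 := rfl

theorem word_cons (a : A) (w : List A) : word (a :: w) = word [a] * word w := by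
  rw [word_mul_word]; rfl

@[simp]
theorem letters_single (a : A) : letters (Finsupp.single a 1) = word [a] := by simp [letters]

@[simp]
theorem letters_zero : letters (0 : A →₀ ℚ) = 0 := by simp [letters]

end WordLift

/-! ### The quasi-shuffle product as a bilinear map -/

section QuasiShuffle

variable {A : Type} (dia : A → A → (A →₀ ℚ))

/-- The quasi-shuffle product as a bilinear map. -/
def qshL : NCPoly A →ₗ[ℚ] NCPoly A →ₗ[ℚ] NCPoly A :=
  wordLift fun u => wordLift (qshWord dia u)

theorem qsh_eq_qshL (f g : NCPoly A) : qsh dia f g = qshL dia f g := by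
  rw [qshL, wordLift_apply, qsh, Finsupp.sum, Finsupp.sum, LinearMap.sum_apply]
  refine Finset.sum_congr rfl fun u _ => ?_
  rw [LinearMap.smul_apply, wordLift_apply, Finsupp.smul_sum]
  simp only [mul_smul]

theorem qshL_word (u v : List A) : qshL dia (word u) (word v) = qshWord dia u v := by
  simp [qshL]

theorem one_qshL (f : NCPoly A) : qshL dia 1 f = f := by
  have : qshL dia (word []) = LinearMap.id := ext_word fun w => by
    rw [qshL_word, qshWord]; rfl
  rw [← word_nil, this]; rfl

theorem qshL_one (f : NCPoly A) : qshL dia f 1 = f := by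
  have : (qshL dia).flip (word []) = LinearMap.id := ext_word fun w => by
    rw [LinearMap.flip_apply, qshL_word]; cases w <;> rw [qshWord] <;> rfl
  rw [← word_nil, ← LinearMap.flip_apply, this]; rfl

/-- By bilinearity the defining recursion needs a single leading letter only; the tails met below
are polynomials such as `transformWord n u`, not words. -/
theorem qshL_letter_mul (a b : A) (f g : NCPoly A) :
    qshL dia (word [a] * f) (word [b] * g) =
      word [a] * qshL dia f (word [b] * g) + word [b] * qshL dia (word [a] * f) g
        + letters (dia a b) * qshL dia f g := by
  induction f using induction_word with
  | zero => simp
  | add f f' hf hf' => simp only [mul_add, map_add, LinearMap.add_apply, hf, hf']; abel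
  | smul r f hf => simp only [mul_smul_comm, map_smul, LinearMap.smul_apply, hf, smul_add]
  | word u =>
    induction g using induction_word with
    | zero => simp
    | add g g' hg hg' => simp only [mul_add, map_add, hg, hg']; abel
    | smul r g hg => simp only [mul_smul_comm, map_smul, hg, smul_add]
    | word v => simp only [← word_cons, qshL_word, qshWord]

end QuasiShuffle

/-! ### The morphism from the stuffle algebra to the balanced algebra -/

section Transform

/-- `n!` times the coefficient of `tⁿ Y_1^{m_1}/m_1! ⋯ Y_d^{m_d}/m_d!` in
`(1 - t b_0)⁻¹ b_{k_1} (1 - (t + Y_1) b_0)⁻¹ ⋯ b_{k_d} (1 - (t + Y_1 + ⋯ + Y_d) b_0)⁻¹`,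
for the word `y_{k_1,m_1} ⋯ y_{k_d,m_d}`. -/
def transformWord : ℕ → List Ybi → NCPoly B
  | 0, [] => 1
  | n + 1, [] => ((n + 1 : ℕ) : ℚ) • (word [0] * transformWord n [])
  | 0, y :: u => word [(y.1 : ℕ)] * transformWord y.2 u
  | n + 1, y :: u => ((n + 1 : ℕ) : ℚ) • (word [0] * transformWord n (y :: u))
      + word [(y.1 : ℕ)] * transformWord (n + 1 + y.2) u
  termination_by n u => (u.length, n)

/-- The linear extension of `transformWord n`. -/
def transform (n : ℕ) : NCPoly Ybi →ₗ[ℚ] NCPoly B := wordLift (transformWord n)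

@[simp]
theorem transform_word (n : ℕ) (w : List Ybi) : transform n (word w) = transformWord n w := by
  simp [transform]

theorem transformWord_nil (n : ℕ) :
    transformWord n [] = if n = 0 then 1 else (n : ℚ) • (word [0] * transformWord (n - 1) []) := by
  cases n <;> simp [transformWord]

theorem transformWord_cons (n : ℕ) (y : Ybi) (u : List Ybi) :
    transformWord n (y :: u) = (n : ℚ) • (word [0] * transformWord (n - 1) (y :: u))
      + word [(y.1 : ℕ)] * transformWord (n + y.2) u := by
  cases n <;> simp [transformWord]

theorem transform_letter_mul (n : ℕ) (y : Ybi) (f : NCPoly Ybi) :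
    transform n (word [y] * f) = (n : ℚ) • (word [0] * transform (n - 1) (word [y] * f))
      + word [(y.1 : ℕ)] * transform (n + y.2) f := by
  induction f using induction_word with
  | zero => simp
  | add f g hf hg => simp only [mul_add, map_add, smul_add, hf, hg]; abel
  | smul r f hf =>
    simp only [mul_smul_comm, map_smul, hf, smul_add]
    rw [smul_comm]
  | word w => rw [← word_cons]; simp only [transform_word]; exact transformWord_cons n y w

theorem diaB_zero_left (j : B) : diaB 0 j = 0 := by simp [diaB]

theorem diaB_zero_right (i : B) : diaB i 0 = 0 := by simp [diaB]

theorem diaB_pnat (k l : ℕ+) : diaB (k : ℕ) (l : ℕ) = Finsupp.single ((k + l : ℕ+) : ℕ) 1 := by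
  rw [diaB, if_pos ⟨k.pos, l.pos⟩, PNat.add_coe]

/-- Both sides have the same expansion by first letter: a leading `b_0` comes from either factor and
carries `p` or `q`, adding up to `p + q`, while leading `b_k` with `k ≥ 1` reproduce the three
stuffle terms. -/
theorem qshL_transformWord (p q : ℕ) (u v : List Ybi) :
    qshL diaB (transformWord p u) (transformWord q v) = transform (p + q) (qshWord diaY u v) := by
  -- Outer induction on the total length, inner on `p + q`: removing a `b_k` shortens a word but may
  -- raise the index, removing a `b_0` keeps the words and lowers it.
  suffices H : ∀ N p q u v, u.length + v.length < N →
      qshL diaB (transformWord p u) (transformWord q v) = transform (p + q) (qshWord diaY u v) from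
    H _ p q u v (Nat.lt_succ_self _)
  intro N
  induction N with
  | zero => intro p q u v h; omega
  | succ N ihN =>
  intro p q u v hN
  suffices H : ∀ K p q, p + q < K →
      qshL diaB (transformWord p u) (transformWord q v) = transform (p + q) (qshWord diaY u v) from
    H _ p q (Nat.lt_succ_self _)
  intro K
  induction K with
  | zero => intro p q h; omega
  | succ K ihK =>
  intro p q hK
  -- The equalities are needed only for nonzero `p`, `q`: at `0` the truncated index `p - 1` is
  -- meaningless, but its term has coefficient zero.
  have shift : ∀ f g h : NCPoly B, ∀ p q : ℕ, (p ≠ 0 → f = h) → (q ≠ 0 → g = h) →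
      (p : ℚ) • (word [0] * f) + (q : ℚ) • (word [0] * g) = ((p + q : ℕ) : ℚ) • (word [0] * h) := by
    intro f g h p q h1 h2
    rw [Nat.cast_add, add_smul]
    congr 1
    · by_cases hp : p = 0
      · simp [hp]
      · rw [h1 hp]
    · by_cases hq : q = 0
      · simp [hq]
      · rw [h2 hq]
  have left : p ≠ 0 → qshL diaB (transformWord (p - 1) u) (transformWord q v)
      = transform (p + q - 1) (qshWord diaY u v) := fun hp => by
    rw [ihK (p - 1) q (by omega)]; congr 2; omega
  have right : q ≠ 0 → qshL diaB (transformWord p u) (transformWord (q - 1) v)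
      = transform (p + q - 1) (qshWord diaY u v) := fun hq => by
    rw [ihK p (q - 1) (by omega)]; congr 2; omega
  have key := shift _ _ _ p q left right
  cases u with
  | nil =>
    by_cases hp : p = 0
    · subst hp
      rw [transformWord_nil, if_pos rfl, one_qshL, qshWord, transform_word, zero_add]
    cases v with
    | nil =>
      by_cases hq : q = 0
      · subst hq
        rw [transformWord_nil 0, if_pos rfl, qshL_one, qshWord, transform_word, add_zero]
      rw [qshWord, transform_word] at key ⊢
      rw [transformWord_nil (p + q), if_neg (by omega), ← key]
      conv_lhs => rw [transformWord_nil p, transformWord_nil q, if_neg hp, if_neg hq]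
      simp only [map_smul, LinearMap.smul_apply]
      rw [qshL_letter_mul, diaB_zero_left, letters_zero, zero_mul, add_zero, smul_add, smul_add]
      congr 1
      · rw [transformWord_nil q, if_neg hq]; simp only [map_smul, mul_smul_comm]
        rw [smul_comm]
      · rw [transformWord_nil p, if_neg hp]; simp only [map_smul, mul_smul_comm, LinearMap.smul_apply]
    | cons y v =>
      have h1 := ihN p (q + y.2) [] v (by simp at hN ⊢; omega)
      rw [qshWord, transform_word] at key h1 ⊢
      rw [transformWord_cons (p + q), ← key, add_assoc p q, ← h1]
      conv_lhs => rw [transformWord_nil p, transformWord_cons q, if_neg hp]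
      conv_rhs =>
        enter [1, 1]
        rw [transformWord_cons q]
      conv_rhs =>
        rw [transformWord_nil p, if_neg hp]
      simp only [map_smul, LinearMap.smul_apply, map_add, qshL_letter_mul, diaB_zero_left,
        letters_zero, zero_mul, add_zero, smul_add, mul_add, mul_smul_comm]
      rw [smul_comm (q : ℚ) (p : ℚ), smul_comm (q : ℚ) (p : ℚ)]
      abel
  | cons x u =>
    cases v with
    | nil =>
      by_cases hq : q = 0
      · subst hq
        rw [transformWord_nil, if_pos rfl, qshL_one, qshWord, transform_word, add_zero]
      have h1 := ihN (p + x.2) q u [] (by simp at hN ⊢; omega)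
      have e : ∀ u, qshWord diaY u [] = word u := fun u => by cases u <;> rw [qshWord]
      rw [e, transform_word] at key h1 ⊢
      rw [transformWord_cons (p + q), ← key, add_right_comm p q, ← h1]
      conv_lhs => rw [transformWord_nil q, transformWord_cons p, if_neg hq]
      conv_rhs =>
        enter [1, 2]
        rw [transformWord_cons p]
      conv_rhs =>
        rw [transformWord_nil q, if_neg hq]
      simp only [map_smul, LinearMap.smul_apply, map_add, LinearMap.add_apply, qshL_letter_mul,
        diaB_zero_right, letters_zero, zero_mul, add_zero, smul_add, mul_add, mul_smul_comm]
      rw [smul_comm (q : ℚ) (p : ℚ)]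
      abel
    | cons y v =>
      have h1 := ihN (p + x.2) q u (y :: v) (by simp at hN ⊢; omega)
      have h2 := ihN p (q + y.2) (x :: u) v (by simp at hN ⊢; omega)
      have h3 := ihN (p + x.2) (q + y.2) u v (by simp at hN ⊢; omega)
      have e : transform (p + q) (qshWord diaY (x :: u) (y :: v)) =
          ((p + q : ℕ) : ℚ) • (word [0] * transform (p + q - 1) (qshWord diaY (x :: u) (y :: v)))
          + word [(x.1 : ℕ)] * transform (p + x.2 + q) (qshWord diaY u (y :: v))
          + word [(y.1 : ℕ)] * transform (p + (q + y.2)) (qshWord diaY (x :: u) v)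
          + word [((x.1 + y.1 : ℕ+) : ℕ)] * transform (p + x.2 + (q + y.2)) (qshWord diaY u v) := by
        rw [qshWord, diaY, letters_single]
        simp only [map_add, mul_add, smul_add]
        rw [transform_letter_mul, transform_letter_mul (p + q) y,
          transform_letter_mul (p + q) (x.1 + y.1, x.2 + y.2)]
        simp only [show p + q + x.2 = p + x.2 + q by omega,
          show p + q + y.2 = p + (q + y.2) by omega,
          show p + q + (x.2 + y.2) = p + x.2 + (q + y.2) by omega]
        abel
      rw [e, ← key, ← h1, ← h2, ← h3]
      -- On the left both factors are expanded; on the right each term has already lost a first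
      -- letter on one side, so only the intact factor is expanded before `qshL_letter_mul` applies.
      conv_lhs => rw [transformWord_cons q, transformWord_cons p]
      conv_rhs =>
        enter [1, 1, 1, 1]
        rw [transformWord_cons q]
      conv_rhs =>
        enter [1, 1, 1, 2]
        rw [transformWord_cons p]
      conv_rhs =>
        enter [1, 1, 2]
        rw [transformWord_cons q]
      conv_rhs =>
        enter [1, 2]
        rw [transformWord_cons p]
      simp only [map_smul, LinearMap.smul_apply, map_add, LinearMap.add_apply, qshL_letter_mul,
        diaB_zero_right, diaB_zero_left, diaB_pnat, letters_single,
        letters_zero, zero_mul, add_zero, smul_add, mul_add, mul_smul_comm]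
      rw [smul_comm (q : ℚ) (p : ℚ), smul_comm (q : ℚ) (p : ℚ)]
      abel

theorem qshL_transform (p q : ℕ) (f g : NCPoly Ybi) :
    qshL diaB (transform p f) (transform q g) = transform (p + q) (qshL diaY f g) := by
  induction f using induction_word with
  | zero => simp
  | add f f' hf hf' => simp only [map_add, LinearMap.add_apply, hf, hf']
  | smul r f hf => simp only [map_smul, LinearMap.smul_apply, hf]
  | word u =>
    induction g using induction_word with
    | zero => simp
    | add g g' hg hg' => simp only [map_add, hg, hg']
    | smul r g hg => simp only [map_smul, hg]
    | word v => rw [transform_word, transform_word, qshL_word, qshL_transformWord]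

theorem transform_zero_mem_B0 (f : NCPoly Ybi) : transform 0 f ∈ NCPolyB0 := by
  induction f using induction_word with
  | zero => simp
  | add f g hf hg => rw [map_add]; exact add_mem hf hg
  | smul r f hf => rw [map_smul]; exact Submodule.smul_mem _ _ hf
  | word w =>
    rw [transform_word]
    cases w with
    | nil => rw [transformWord_nil, if_pos rfl]; exact word_mem_B0 (w := []) (by simp)
    | cons y u => rw [transformWord]; exact letter_mul_mem_B0 y.1.ne_zero _

/-- `transform 0` as a map `(ℚ⟨Ybi⟩, *) → (ℚ⟨B⟩⁰, *_b)`; it is a surjective morphism. -/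
def transform0 : NCPoly Ybi →ₗ[ℚ] NCPolyB0 :=
  (transform 0).codRestrict NCPolyB0 transform_zero_mem_B0

theorem coe_transform0 (f : NCPoly Ybi) : (transform0 f : NCPoly B) = transform 0 f := rfl

theorem transform0_one : transform0 1 = ⟨word [], word_mem_B0 (by simp)⟩ := by
  apply Subtype.ext
  rw [coe_transform0, ← word_nil, transform_word, transformWord_nil, if_pos rfl]
  rfl

theorem transform0_stuffle (f g : NCPoly Ybi) :
    transform0 (stuffle f g) = balanced0 (transform0 f) (transform0 g) := by
  apply Subtype.ext
  simp only [coe_transform0, balanced0, balanced, stuffle, qsh_eq_qshL]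
  rw [qshL_transform]

theorem letter_mul_transform_mem_range (k : ℕ+) (n : ℕ) (f : NCPoly Ybi) :
    word [(k : ℕ)] * transform n f = transform 0 (word [(k, n)] * f) := by
  rw [transform_letter_mul]; simp

/-- The sum of all ranges is stable under prepending a letter: `b_k` with `k ≥ 1` lands in the range
of `transform 0`, and `b_0` raises the index by one, up to such a term. -/
theorem word_mem_iSup_range (w : List B) :
    word w ∈ ⨆ n, LinearMap.range (transform n) := by
  have mem (n : ℕ) (f : NCPoly Ybi) : transform n f ∈ ⨆ n, LinearMap.range (transform n) :=
    Submodule.mem_iSup_of_mem n ⟨f, rfl⟩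
  induction w with
  | nil =>
    have h := mem 0 (word [])
    rwa [transform_word, transformWord_nil, if_pos rfl] at h
  | cons b w ih =>
    rw [word_cons]
    generalize word w = f at ih ⊢
    induction ih using Submodule.iSup_induction' with
    | zero => simp
    | add f g _ _ hf hg => rw [mul_add]; exact add_mem hf hg
    | mem n f hf =>
      obtain ⟨f, rfl⟩ := hf
      rcases Nat.eq_zero_or_pos b with rfl | hb
      -- The recursion for `transform (n + 1)` produces `b_0` with the factor `n + 1`, which is
      -- invertible over `ℚ`.
      · have hn : ((n + 1 : ℕ) : ℚ) ≠ 0 := by positivity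
        rw [← Submodule.smul_mem_iff _ hn]
        induction f using induction_word with
        | zero => simp
        | add f g hf hg => rw [map_add, mul_add, smul_add]; exact add_mem hf hg
        | smul r f hf =>
          rw [map_smul, mul_smul_comm, smul_comm]; exact Submodule.smul_mem _ _ hf
        | word u =>
          cases u with
          | nil =>
            have h := mem (n + 1) (word [])
            rw [transform_word, transformWord] at h
            rwa [transform_word]
          | cons y u =>
            have h := transform_letter_mul (n + 1) y (word u)
            rw [letter_mul_transform_mem_range, Nat.add_sub_cancel, ← word_cons] at h
            rw [eq_sub_of_add_eq h.symm]
            exact sub_mem (mem _ _) (mem _ _)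
      · lift b to ℕ+ using hb
        rw [letter_mul_transform_mem_range]
        exact mem _ _

/-- A leading `b_k`, `k ≥ 1`, moves an element of any range, hence of their sum, into the range of
`transform 0`: the index `n` is stored in the new letter `y_{k,n}`. -/
theorem transform0_surjective : Function.Surjective transform0 := by
  suffices h : NCPolyB0 ≤ LinearMap.range (transform 0) by
    rintro ⟨f, hf⟩
    obtain ⟨g, hg⟩ := h hf
    exact ⟨g, Subtype.ext hg⟩
  rw [NCPolyB0, Submodule.span_le]
  rintro _ ⟨w, hw, rfl⟩
  cases w with
  | nil => exact ⟨word [], by rw [transform_word, transformWord_nil, if_pos rfl]; rfl⟩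
  | cons b w =>
    have hb : 0 < b := Nat.pos_of_ne_zero (by simpa using hw)
    lift b to ℕ+ using hb
    rw [word_cons]
    have h := word_mem_iSup_range w
    generalize word w = f at h ⊢
    induction h using Submodule.iSup_induction' with
    | zero => simp
    | add f g _ _ hf hg => rw [mul_add]; exact add_mem hf hg
    | mem n f hf =>
      obtain ⟨f, rfl⟩ := hf
      rw [letter_mul_transform_mem_range]
      exact ⟨_, rfl⟩

end Transform

/-! ### Composition of linear substitutions in power series -/

section LinearSubstitution

variable {ρ σ τ R : Type*} [Ring R] [Algebra ℚ R]

theorem prod_pow_eq_bind₁ (L : σ → MvPolynomial τ ℚ) (e : σ →₀ ℕ) :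
    (e.prod fun s k => L s ^ k) = MvPolynomial.bind₁ L (MvPolynomial.monomial e 1) := by
  rw [MvPolynomial.bind₁_monomial, map_one, one_mul]; rfl

theorem isHomogeneous_prod_pow {L : σ → MvPolynomial τ ℚ} (hL : ∀ s, (L s).IsHomogeneous 1)
    (e : σ →₀ ℕ) : (e.prod fun s k => L s ^ k).IsHomogeneous e.degree := by
  refine MvPolynomial.IsHomogeneous.prod _ _ _ fun s _ => ?_
  simpa using (hL s).pow (e s)

theorem coeff_prod_pow_eq_zero {L : σ → MvPolynomial τ ℚ} (hL : ∀ s, (L s).IsHomogeneous 1)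
    {e : σ →₀ ℕ} {n : τ →₀ ℕ} (h : e.degree ≠ n.degree) :
    MvPolynomial.coeff n (e.prod fun s k => L s ^ k) = 0 :=
  (isHomogeneous_prod_pow hL e).coeff_eq_zero h.symm

theorem finite_degree_eq (σ : Type*) [Finite σ] (N : ℕ) : {e : σ →₀ ℕ | e.degree = N}.Finite :=
  (Finsupp.finite_of_degree_le N).subset fun _ h => le_of_eq h

/-- The exponents of total degree `N`. -/
def degreeEq (σ : Type*) [Finite σ] (N : ℕ) : Finset (σ →₀ ℕ) := (finite_degree_eq σ N).toFinset

@[simp]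
theorem mem_degreeEq [Finite σ] {N : ℕ} {e : σ →₀ ℕ} : e ∈ degreeEq σ N ↔ e.degree = N := by
  simp [degreeEq]

theorem substPoly_apply [Finite σ] {L : σ → MvPolynomial τ ℚ} (hL : ∀ s, (L s).IsHomogeneous 1)
    (f : MvPowerSeries σ R) (n : τ →₀ ℕ) :
    substPoly L f n = ∑ e ∈ degreeEq σ n.degree,
      MvPolynomial.coeff n (e.prod fun s k => L s ^ k) • f e := by
  refine finsum_eq_sum_of_support_subset _ fun e he => ?_
  rw [mem_coe, mem_degreeEq]
  by_contra h
  exact he (by simp only [coeff_prod_pow_eq_zero hL h, zero_smul])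

theorem coeff_bind₁_of_isHomogeneous [Finite σ] (L : σ → MvPolynomial τ ℚ)
    {p : MvPolynomial σ ℚ} {N : ℕ} (hp : p.IsHomogeneous N) (n : τ →₀ ℕ) :
    MvPolynomial.coeff n (MvPolynomial.bind₁ L p) = ∑ e ∈ degreeEq σ N,
      MvPolynomial.coeff n (e.prod fun s k => L s ^ k) * MvPolynomial.coeff e p := by
  conv_lhs => rw [p.as_sum]
  rw [map_sum, MvPolynomial.coeff_sum]
  refine (Finset.sum_subset (fun e he => ?_) fun e _ he => ?_).trans
    (Finset.sum_congr rfl fun e _ => ?_)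
  · rw [mem_degreeEq]
    by_contra h
    exact (MvPolynomial.mem_support_iff.1 he) (hp.coeff_eq_zero h)
  · rw [MvPolynomial.notMem_support_iff.1 he]; simp
  · rw [prod_pow_eq_bind₁, ← mul_one (MvPolynomial.coeff e p), ← smul_eq_mul,
      ← MvPolynomial.smul_monomial, map_smul, MvPolynomial.coeff_smul, smul_eq_mul, smul_eq_mul,
      mul_one, mul_comm]

/-- Linear forms preserve total degree, so every coefficient is a sum over the finitely many
exponents of one degree, and the two sums may be exchanged. -/
theorem substPoly_substPoly [Finite ρ] [Finite σ] {L : σ → MvPolynomial τ ℚ}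
    {L' : ρ → MvPolynomial σ ℚ} (hL : ∀ s, (L s).IsHomogeneous 1)
    (hL' : ∀ s, (L' s).IsHomogeneous 1) (f : MvPowerSeries ρ R) :
    substPoly L (substPoly L' f) = substPoly (fun s => MvPolynomial.bind₁ L (L' s)) f := by
  have hLL' (s : ρ) : (MvPolynomial.bind₁ L (L' s)).IsHomogeneous 1 := by
    have := (hL' s).aeval L (n := 1) hL
    rwa [one_mul] at this
  ext n
  change substPoly L _ n = substPoly _ _ n
  rw [substPoly_apply hL, substPoly_apply hLL']
  calc _ = ∑ e' ∈ degreeEq σ n.degree, ∑ e ∈ degreeEq ρ n.degree,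
        (MvPolynomial.coeff n (e'.prod fun s k => L s ^ k) *
          MvPolynomial.coeff e' (e.prod fun s k => L' s ^ k)) • f e := by
        refine Finset.sum_congr rfl fun e' he' => ?_
        rw [substPoly_apply hL', mem_degreeEq.1 he', Finset.smul_sum]
        simp only [mul_smul]
    _ = _ := by
        rw [Finset.sum_comm]
        refine Finset.sum_congr rfl fun e he => ?_
        rw [← Finset.sum_smul, ← mem_degreeEq.1 he,
          ← coeff_bind₁_of_isHomogeneous L (isHomogeneous_prod_pow hL' e)]
        congr 2
        simp [Finsupp.prod]

theorem substPoly_X (f : MvPowerSeries σ R) : substPoly MvPolynomial.X f = f := by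
  classical
  ext n
  refine (finsum_eq_single _ n fun e he => ?_).trans ?_
  · rw [prod_pow_eq_bind₁, MvPolynomial.bind₁_X_left, AlgHom.id_apply, MvPolynomial.coeff_monomial,
      if_neg he, zero_smul]
  · rw [prod_pow_eq_bind₁, MvPolynomial.bind₁_X_left, AlgHom.id_apply, MvPolynomial.coeff_monomial,
      if_pos rfl, one_smul]

end LinearSubstitution

/-! ### `τ`-invariance and swap invariance -/

section Symmetries

variable {R : Type*} [Ring R] [Algebra ℚ R] {d : ℕ}

theorem isHomogeneous_varX (i : Fin d) : (varX i).IsHomogeneous 1 :=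
  MvPolynomial.isHomogeneous_X _ _

theorem isHomogeneous_varY (i : Fin d) : (varY i).IsHomogeneous 1 :=
  MvPolynomial.isHomogeneous_X _ _

theorem isHomogeneous_sumY (i : Fin d) : (sumY i).IsHomogeneous 1 :=
  MvPolynomial.IsHomogeneous.sum _ _ _ fun j _ => isHomogeneous_varY j

theorem isHomogeneous_diffX (i : Fin d) : (diffX i).IsHomogeneous 1 := by
  refine (isHomogeneous_varX _).sub ?_
  split_ifs
  · exact MvPolynomial.isHomogeneous_zero _ _ _
  · exact isHomogeneous_varX _

/-- Telescoping sum; this is how partial sums undo the differences in `swap`. -/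
theorem sum_diffX (i : Fin d) : ∑ j ∈ Finset.Iic i, diffX j = varX i.rev := by
  obtain ⟨i, hi⟩ := i
  induction i with
  | zero =>
    have : Finset.Iic (⟨0, hi⟩ : Fin d) = {⟨0, hi⟩} := by
      ext j; simp [Fin.le_def, Fin.ext_iff]
    rw [this, Finset.sum_singleton, diffX, dif_pos rfl, sub_zero]
  | succ i ih =>
    have : Finset.Iic (⟨i + 1, hi⟩ : Fin d)
        = insert ⟨i + 1, hi⟩ (Finset.Iic (⟨i, by omega⟩ : Fin d)) := by
      ext j; simp [Fin.le_def, Fin.ext_iff]; omega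
    rw [this, Finset.sum_insert (by simp [Fin.le_def]), ih (by omega), diffX,
      dif_neg (Nat.succ_ne_zero i)]
    have e : (⟨d - (i + 1), by omega⟩ : Fin d) = Fin.rev ⟨i, by omega⟩ := by
      simp [Fin.ext_iff]
    rw [e]; abel

/-- The substitution `X_i ↦ Y_{d+1-i}`, `Y_i ↦ X_{d+1-i} - X_{d+2-i}`. -/
def unsharpTau (i : Fin d ⊕ Fin d) : MvPolynomial (Fin d ⊕ Fin d) ℚ :=
  Sum.elim (fun i => varY i.rev) diffX i

theorem substPoly_unsharpTau_sharpY (M : Bimould R) (d : ℕ) :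
    substPoly unsharpTau (sharpY M d) = tau M d := by
  rw [sharpY, substPoly_substPoly, tau]
  · congr 1
    funext s
    rcases s with i | i
    · simp [varX, unsharpTau]
    · simp [sumY, varY, unsharpTau, sum_diffX]
  · rintro (i | i)
    exacts [isHomogeneous_varY _, isHomogeneous_diffX i]
  · rintro (i | i)
    exacts [isHomogeneous_varX _, isHomogeneous_sumY i]

theorem tau_tau (M : Bimould R) : tau (tau M) = M := by
  funext d
  have h : ∀ s : Fin d ⊕ Fin d, (Sum.elim (fun i : Fin d => varY i.rev)
      (fun i : Fin d => varX i.rev) s).IsHomogeneous 1 := by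
    rintro (i | i)
    exacts [isHomogeneous_varY _, isHomogeneous_varX _]
  refine (substPoly_substPoly h h (M d)).trans ?_
  convert substPoly_X (M d) using 2
  funext s
  rcases s with i | i <;> simp [varX, varY]

/-- `unsharpTau` recovers `tau M` from `sharpY M`, and `tau` is an involution. -/
theorem sharpY_injective : Function.Injective (sharpY : Bimould R → Bimould R) := by
  intro M N h
  have : tau M = tau N := by
    funext d
    rw [← substPoly_unsharpTau_sharpY, ← substPoly_unsharpTau_sharpY, h]
  rw [← tau_tau M, this, tau_tau]

/-- Both composites substitute `X_i ↦ Y_1 + ⋯ + Y_{d+1-i}` and `Y_i ↦ X_{d+1-i}`. -/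
theorem swap_sharpY (M : Bimould R) : swap (sharpY M) = sharpY (tau M) := by
  funext d
  rw [swap, sharpY, sharpY, tau, substPoly_substPoly, substPoly_substPoly]
  · congr 1
    funext s
    rcases s with i | i
    · simp [varX, varY]
    · simp [sumY, varY, varX, sum_diffX]
  · rintro (i | i)
    exacts [isHomogeneous_varX _, isHomogeneous_sumY i]
  · rintro (i | i)
    exacts [isHomogeneous_varY _, isHomogeneous_varX _]
  · rintro (i | i)
    exacts [isHomogeneous_sumY _, isHomogeneous_diffX i]
  · rintro (i | i)
    exacts [isHomogeneous_varX _, isHomogeneous_sumY i]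

theorem tauInvariant_iff_swapInvariant_sharpY (M : Bimould R) :
    TauInvariant M ↔ SwapInvariant (sharpY M) := by
  rw [TauInvariant, SwapInvariant, swap_sharpY, sharpY_injective.eq_iff]

theorem sharpY_zero (M : Bimould R) : sharpY M 0 = M 0 := by
  have h : Sum.elim varX sumY = (MvPolynomial.X : Fin 0 ⊕ Fin 0 → MvPolynomial _ ℚ) :=
    funext fun s => isEmptyElim s
  rw [sharpY, h, substPoly_X]

end Symmetries

/-! ### Coefficients of products of powers of partial sums -/

section PartialSums

/-- The partial sum `Z_0 + ⋯ + Z_i`. -/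
def partialSum {d : ℕ} (i : Fin d) : MvPolynomial (Fin d) ℚ :=
  ∑ j ∈ Finset.Iic i, MvPolynomial.X j

theorem partialSum_eq {d : ℕ} (i : Fin d) :
    partialSum i = ∑ j, if j ≤ i then (MvPolynomial.X j : MvPolynomial (Fin d) ℚ) else 0 := by
  rw [partialSum, ← Finset.sum_filter]
  congr 1
  ext j; simp

theorem isHomogeneous_partialSum {d : ℕ} (i : Fin d) : (partialSum i).IsHomogeneous 1 :=
  MvPolynomial.IsHomogeneous.sum _ _ _ fun _ _ => MvPolynomial.isHomogeneous_X _ _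

/-- The coefficient of `Z^μ` in `∏ (Z_0 + ⋯ + Z_i)^{m_i}`. -/
def partialCoeff {d : ℕ} (μ m : Fin d →₀ ℕ) : ℚ :=
  MvPolynomial.coeff μ (m.prod fun i k => partialSum i ^ k)

theorem partialCoeff_eq {d : ℕ} (μ m : Fin d →₀ ℕ) :
    partialCoeff μ m = MvPolynomial.coeff μ (∏ i, partialSum i ^ m i) := by
  rw [partialCoeff, Finsupp.prod_fintype _ _ fun _ => pow_zero _]

theorem finite_support_partialCoeff {d : ℕ} (μ : Fin d →₀ ℕ) :
    (Function.support (partialCoeff μ)).Finite :=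
  (finite_degree_eq (Fin d) μ.degree).subset fun m hm => by
    by_contra h
    exact hm (coeff_prod_pow_eq_zero isHomogeneous_partialSum h)

theorem hasFiniteSupport_partialCoeff_smul {d : ℕ} {V : Type*} [AddCommGroup V] [Module ℚ V]
    (μ : Fin d →₀ ℕ) (g : (Fin d →₀ ℕ) → V) :
    Function.HasFiniteSupport fun m => partialCoeff μ m • g m :=
  (finite_support_partialCoeff μ).subset fun m hm h => hm (by simp only [h, zero_smul])

/-- The substitution `Z_0 ↦ Z_0 + Z_1`, `Z_i ↦ Z_{i+1}` for `i ≥ 1`. -/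
def mergeHom (d : ℕ) : MvPolynomial (Fin (d + 1)) ℚ →ₐ[ℚ] MvPolynomial (Fin (d + 2)) ℚ :=
  MvPolynomial.aeval (Fin.cons (MvPolynomial.X 0 + MvPolynomial.X 1)
    fun i : Fin d => MvPolynomial.X i.succ.succ)

theorem mergeHom_partialSum {d : ℕ} (i : Fin (d + 1)) :
    mergeHom d (partialSum i) = partialSum i.succ := by
  have h : (1 : Fin (d + 2)) ≤ i.succ := by
    rw [← Fin.succ_zero_eq_one, Fin.succ_le_succ_iff]; exact Fin.zero_le _
  simp only [partialSum_eq, Fin.sum_univ_succ, mergeHom]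
  simp [apply_ite, Fin.succ_le_succ_iff, add_assoc, h]

theorem partialSum_zero {d : ℕ} : partialSum (0 : Fin (d + 1)) = MvPolynomial.X 0 := by
  rw [partialSum, show Finset.Iic (0 : Fin (d + 1)) = {0} by ext j; simp, Finset.sum_singleton]

theorem monomial_cons_cons {d : ℕ} (a b : ℕ) (c : Fin d →₀ ℕ) :
    (MvPolynomial.monomial (Finsupp.cons a (Finsupp.cons b c)) (1 : ℚ)) =
      MvPolynomial.X 0 ^ a * MvPolynomial.X 1 ^ b * ∏ i, MvPolynomial.X i.succ.succ ^ c i := by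
  rw [MvPolynomial.monomial_eq, map_one, one_mul, Finsupp.prod_fintype _ _ fun _ => pow_zero _,
    Fin.prod_univ_succ, Fin.prod_univ_succ, mul_assoc]
  simp only [Finsupp.cons_zero, Finsupp.cons_succ]
  rfl

theorem mergeHom_monomial {d : ℕ} (u : Fin (d + 1) →₀ ℕ) (r : ℚ) :
    mergeHom d (MvPolynomial.monomial u r) = r • ∑ p ∈ antidiagonal (u 0), ((u 0).choose p.1 : ℚ) •
      MvPolynomial.monomial (Finsupp.cons p.1 (Finsupp.cons p.2 (Finsupp.tail u))) 1 := by
  rw [mergeHom, MvPolynomial.aeval_monomial, ← Algebra.smul_def,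
    Finsupp.prod_fintype _ _ fun _ => pow_zero _, Fin.prod_univ_succ, Fin.cons_zero,
    (Commute.all _ _).add_pow', Finset.sum_mul]
  congr 1
  refine Finset.sum_congr rfl fun p _ => ?_
  rw [monomial_cons_cons, smul_mul_assoc, Nat.cast_smul_eq_nsmul]
  simp [Finsupp.tail, Fin.tail]

/-- The monomial `Z_0^a Z_1^b` can only arise from `(Z_0 + Z_1)^(a+b)`, with a binomial coefficient.
-/
theorem coeff_mergeHom {d : ℕ} (a b : ℕ) (c : Fin d →₀ ℕ) (Q : MvPolynomial (Fin (d + 1)) ℚ) :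
    MvPolynomial.coeff (Finsupp.cons a (Finsupp.cons b c)) (mergeHom d Q) =
      ((a + b).choose a : ℚ) * MvPolynomial.coeff (Finsupp.cons (a + b) c) Q := by
  classical
  induction Q using MvPolynomial.induction_on' with
  | add p q hp hq => rw [map_add, MvPolynomial.coeff_add, hp, hq, MvPolynomial.coeff_add, mul_add]
  | monomial u r =>
    rw [mergeHom_monomial, MvPolynomial.coeff_smul, MvPolynomial.coeff_sum,
      MvPolynomial.coeff_monomial]
    simp only [MvPolynomial.coeff_smul, MvPolynomial.coeff_monomial, smul_eq_mul, mul_ite, mul_one,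
      mul_zero]
    have hinj (p : ℕ × ℕ) : Finsupp.cons p.1 (Finsupp.cons p.2 (Finsupp.tail u)) =
        Finsupp.cons a (Finsupp.cons b c) ↔ p = (a, b) ∧ Finsupp.tail u = c := by
      rw [Finsupp.cons_injective2.eq_iff, Finsupp.cons_injective2.eq_iff, Prod.ext_iff, and_assoc]
    have hu : u = Finsupp.cons (a + b) c ↔ (a + b = u 0) ∧ Finsupp.tail u = c := by
      conv_lhs => rw [← Finsupp.cons_tail u, Finsupp.cons_injective2.eq_iff]
      rw [eq_comm (a := u 0)]
    simp only [hinj, hu, ite_and]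
    rw [Finset.sum_ite_eq']
    simp only [HasAntidiagonal.mem_antidiagonal]
    by_cases h : a + b = u 0
    · rw [if_pos h, if_pos h, h, mul_comm]
      split_ifs <;> simp
    · rw [if_neg h, if_neg h, mul_zero]

/-- The first factor is `Z_0^{m₀}`; all later partial sums involve `Z_0` and `Z_1` only through `Z_0
+ Z_1`. This matches the passage from index `n` to `n - j + m` when `transformWord` loses a letter.
-/
theorem partialCoeff_cons_cons {d : ℕ} (n b m₀ : ℕ) (c : Fin d →₀ ℕ) (m : Fin (d + 1) →₀ ℕ) :
    partialCoeff (Finsupp.cons n (Finsupp.cons b c)) (Finsupp.cons m₀ m) =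
      if m₀ ≤ n then ((n - m₀ + b).choose (n - m₀) : ℚ) *
        partialCoeff (Finsupp.cons (n - m₀ + b) c) m else 0 := by
  have hle : (Finsupp.single 0 m₀ ≤ Finsupp.cons n (Finsupp.cons b c)) ↔ m₀ ≤ n := by
    rw [Finsupp.single_le_iff, Finsupp.cons_zero]
  have hsub : Finsupp.cons n (Finsupp.cons b c) - Finsupp.single 0 m₀ =
      Finsupp.cons (n - m₀) (Finsupp.cons b c) := by
    ext i
    refine Fin.cases ?_ (fun i => ?_) i <;> simp
  rw [partialCoeff_eq, partialCoeff_eq, Fin.prod_univ_succ, partialSum_zero, Finsupp.cons_zero,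
    MvPolynomial.X_pow_eq_monomial, MvPolynomial.coeff_monomial_mul']
  simp only [hle, hsub, Finsupp.cons_succ, ← mergeHom_partialSum, ← map_pow, ← map_prod,
    coeff_mergeHom, one_mul]

theorem partialCoeff_one (n m₀ : ℕ) (μ m : Fin 0 →₀ ℕ) :
    partialCoeff (Finsupp.cons n μ) (Finsupp.cons m₀ m) = if m₀ = n then 1 else 0 := by
  classical
  rw [partialCoeff_eq, Fin.prod_univ_succ, partialSum_zero, Finsupp.cons_zero, Fin.prod_univ_zero,
    mul_one, MvPolynomial.X_pow_eq_monomial, MvPolynomial.coeff_monomial]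
  refine if_congr ?_ rfl rfl
  rw [Subsingleton.elim μ 0, Finsupp.cons_zero_eq_single_zero,
    (Finsupp.single_injective 0).eq_iff]

theorem partialCoeff_cons_zero {d : ℕ} (m₀ : ℕ) (μ m : Fin d →₀ ℕ) :
    partialCoeff (Finsupp.cons 0 μ) (Finsupp.cons m₀ m) = if m₀ = 0 then partialCoeff μ m else 0 := by
  cases d with
  | zero =>
    rw [partialCoeff_one, partialCoeff_eq, Fin.prod_univ_zero, Subsingleton.elim μ 0,
      MvPolynomial.coeff_zero_one]
  | succ d =>
    conv_lhs => rw [← Finsupp.cons_tail μ]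
    rw [partialCoeff_cons_cons]
    simp

end PartialSums

/-! ### Reindexing finitely supported sums -/

section FiniteSums

theorem finsum_eq_finsum_comp {α β V : Type*} [AddCommMonoid V] {g : β → α}
    (hg : Function.Injective g) (f : α → V) (h : ∀ a, a ∉ Set.range g → f a = 0) :
    ∑ᶠ a, f a = ∑ᶠ b, f (g b) := by
  rw [← finsum_mem_range hg]
  refine finsum_congr fun a => ?_
  by_cases ha : a ∈ Set.range g
  · simp only [ha, finsum_true]
  · simp only [ha, finsum_false, h a ha]

theorem finsum_cons {d : ℕ} {V : Type*} [AddCommMonoid V] (f : (Fin (d + 1) →₀ ℕ) → V)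
    (hf : Function.HasFiniteSupport f) :
    ∑ᶠ m, f m = ∑ᶠ (a : ℕ) (m : Fin d →₀ ℕ), f (Finsupp.cons a m) := by
  have hinj : Function.Injective fun p : ℕ × (Fin d →₀ ℕ) => Finsupp.cons p.1 p.2 := by
    rintro ⟨a, m⟩ ⟨b, m'⟩ h
    exact Prod.ext_iff.2 (Finsupp.cons_injective2 h)
  rw [finsum_eq_finsum_comp hinj f, finsum_curry]
  · exact Set.Finite.preimage hinj.injOn hf
  · intro m hm
    exact (hm ⟨(m 0, Finsupp.tail m), Finsupp.cons_tail m⟩).elim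

end FiniteSums

/-! ### Expansion of the transform in words of blocks -/

section TransformExpansion

theorem inv_factorial_smul_transformWord_nil (n : ℕ) :
    ((n.factorial : ℚ)⁻¹) • transformWord n [] = word (List.replicate n 0) := by
  induction n with
  | zero => simp [transformWord, word_nil]
  | succ n ih =>
    rw [List.replicate_succ, word_cons, ← ih, transformWord, smul_smul, mul_smul_comm]
    congr 1
    rw [Nat.factorial_succ]
    push_cast
    field_simp

/-- The recursion in `n` iterated until the first `b_k`; `j` counts the `b_0` in front of it. -/
theorem inv_factorial_smul_transformWord_cons (n : ℕ) (y : Ybi) (u : List Ybi) :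
    ((n.factorial : ℚ)⁻¹) • transformWord n (y :: u) = ∑ j ∈ range (n + 1),
      (((n - j).factorial : ℚ)⁻¹) •
        (word (List.replicate j 0 ++ [(y.1 : ℕ)]) * transformWord (n - j + y.2) u) := by
  induction n with
  | zero => simp [transformWord]
  | succ n ih =>
    have h : ((n + 1).factorial : ℚ)⁻¹ * ((n + 1 : ℕ) : ℚ) = (n.factorial : ℚ)⁻¹ := by
      rw [Nat.factorial_succ]
      push_cast
      field_simp
    rw [transformWord, smul_add, smul_smul, h, ← mul_smul_comm, ih,
      Finset.sum_range_succ' _ (n + 1), Finset.mul_sum]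
    congr 1
    refine Finset.sum_congr rfl fun j _ => ?_
    rw [List.replicate_succ, List.cons_append, word_cons 0 (_ ++ _), mul_smul_comm, mul_assoc,
      Nat.succ_sub_succ]

theorem blockWord_succ {d : ℕ} (κ m : Fin (d + 1) → ℕ) :
    blockWord κ m = [κ 0 + 1] ++ (List.replicate (m 0) 0 ++
      blockWord (fun i => κ i.succ) fun i => m i.succ) := by
  simp [blockWord, List.ofFn_succ]

/-- Here `Z_0` plays the role of `t` and `Z_i` that of `Y_i`; both sides satisfy the same recursion
in `d`. The map `F` is left arbitrary so that the induction can absorb the prefix of a word into it.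
-/
theorem map_transformWord_eq_finsum {V : Type*} [AddCommGroup V] [Module ℚ V] {d : ℕ}
    (κ : Fin d → ℕ) (μ : Fin d →₀ ℕ) (n : ℕ) (F : NCPoly B →ₗ[ℚ] V) :
    (((n.factorial : ℚ)⁻¹) * ∏ i, ((μ i).factorial : ℚ)⁻¹) •
        F (transformWord n (List.ofFn fun i => ((κ i).succPNat, μ i))) =
      ∑ᶠ m : Fin (d + 1) →₀ ℕ, partialCoeff (Finsupp.cons n μ) m •
        F (word (List.replicate (m 0) 0 ++ blockWord κ (Finsupp.tail m))) := by
  induction d generalizing n F with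
  | zero =>
    rw [finsum_eq_single _ (Finsupp.cons n 0)]
    · rw [partialCoeff_one, if_pos rfl, Fin.prod_univ_zero, mul_one, List.ofFn_zero, ← map_smul,
        inv_factorial_smul_transformWord_nil]
      simp [blockWord]
    · intro m hm
      rw [← Finsupp.cons_tail m, partialCoeff_one, if_neg, zero_smul]
      intro h
      apply hm
      rw [← h, ← Subsingleton.elim (Finsupp.tail m) 0, Finsupp.cons_tail]
  | succ d ih =>
    obtain ⟨b, c, rfl⟩ : ∃ b c, μ = Finsupp.cons b c := ⟨_, _, (Finsupp.cons_tail μ).symm⟩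
    rw [finsum_cons _ (hasFiniteSupport_partialCoeff_smul _ _),
      finsum_eq_sum_of_support_subset (s := range (n + 1))]
    · rw [mul_comm, mul_smul, ← map_smul, List.ofFn_succ, inv_factorial_smul_transformWord_cons,
        map_sum, Finset.smul_sum]
      refine Finset.sum_congr rfl fun j hj => ?_
      have hj' : j ≤ n := Nat.lt_succ_iff.1 (mem_range.1 hj)
      set N := n - j + b with hN
      have h := ih (fun i => κ i.succ) c N
        (F ∘ₗ LinearMap.mulLeft ℚ (word (List.replicate j 0 ++ [κ 0 + 1])))
      -- The binomial coefficient of `partialCoeff_cons_cons` is exactly the cost of replacing `(n -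
      -- j)!` and `b!` by `N!`.
      have hc : (∏ i, ((Finsupp.cons b c i).factorial : ℚ)⁻¹) * ((n - j).factorial : ℚ)⁻¹ =
          (N.choose (n - j) : ℚ) * ((N.factorial : ℚ)⁻¹ * ∏ i, ((c i).factorial : ℚ)⁻¹) := by
        have h1 : (N.choose (n - j) : ℚ) = N.factorial / ((n - j).factorial * b.factorial) := by
          rw [hN, Nat.choose_symm_add, Nat.add_choose, Nat.cast_div (Nat.factorial_mul_factorial_dvd_factorial_add _ _)
            (by positivity)]
          push_cast; rfl
        rw [h1, Fin.prod_univ_succ, Finsupp.cons_zero]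
        simp only [Finsupp.cons_succ]
        field_simp
      simp only [Finsupp.cons_zero, Finsupp.cons_succ, map_smul, Nat.succPNat_coe]
      rw [← hN, smul_smul, hc, mul_smul]
      refine (congrArg _ h).trans ?_
      rw [smul_finsum' _ (hasFiniteSupport_partialCoeff_smul _ _)]
      refine finsum_congr fun m => ?_
      rw [partialCoeff_cons_cons, if_pos hj', smul_smul, ← hN]
      congr 1
      rw [LinearMap.comp_apply, LinearMap.mulLeft_apply, word_mul_word, blockWord_succ,
        List.append_assoc, Finsupp.tail_cons]
      rfl
    · intro j hj
      by_contra h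
      refine hj ((finsum_congr fun m => ?_).trans finsum_zero)
      rw [partialCoeff_cons_cons, if_neg (by simpa using h), zero_smul]

theorem map_transform_zero_eq_finsum {V : Type*} [AddCommGroup V] [Module ℚ V] {d : ℕ}
    (κ : Fin d → ℕ) (μ : Fin d →₀ ℕ) (F : NCPoly B →ₗ[ℚ] V) :
    (∏ i, ((μ i).factorial : ℚ)⁻¹) • F (transform 0 (wordY κ μ)) =
      ∑ᶠ m : Fin d →₀ ℕ, partialCoeff μ m • F (word (blockWord κ m)) := by
  have h := map_transformWord_eq_finsum κ μ 0 F
  rw [Nat.factorial_zero, Nat.cast_one, inv_one, one_mul] at h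
  rw [wordY, transform_word, h,
    finsum_eq_finsum_comp (Finsupp.cons_right_injective (0 : ℕ))]
  · refine finsum_congr fun m => ?_
    rw [partialCoeff_cons_zero, if_pos rfl]
    simp
  · intro m hm
    have hm0 : m 0 ≠ 0 := fun h0 => hm ⟨Finsupp.tail m, by
      conv_rhs => rw [← Finsupp.cons_tail m, h0]⟩
    rw [← Finsupp.cons_tail m, partialCoeff_cons_zero, if_neg hm0, zero_smul]

end TransformExpansion

/-! ### The effect of `#_Y` on generating series -/

section GeneratingSeries

variable {R : Type*} [Ring R] [Algebra ℚ R]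

theorem coeff_sumElim_mul_rename {σ τ : Type*} [DecidableEq σ] [DecidableEq τ] (κ κ' : σ →₀ ℕ) (μ : τ →₀ ℕ)
    (Q : MvPolynomial τ ℚ) :
    MvPolynomial.coeff (Finsupp.sumElim κ μ)
      (MvPolynomial.monomial (Finsupp.sumElim κ' 0) 1 * MvPolynomial.rename Sum.inr Q) =
    if κ' = κ then MvPolynomial.coeff μ Q else 0 := by
  induction Q using MvPolynomial.induction_on' with
  | add p q hp hq =>
    rw [map_add, mul_add, MvPolynomial.coeff_add, hp, hq, MvPolynomial.coeff_add]
    split_ifs <;> simp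
  | monomial u r =>
    rw [MvPolynomial.rename_monomial, MvPolynomial.monomial_mul, one_mul,
      MvPolynomial.coeff_monomial, MvPolynomial.coeff_monomial, ← ite_and]
    refine if_congr ?_ rfl rfl
    have : Finsupp.sumElim κ' 0 + Finsupp.mapDomain Sum.inr u = Finsupp.sumElim κ' u := by
      simp [Finsupp.sumElim_eq_add]
    rw [this, ← Prod.mk.injEq]
    exact (Finsupp.sumFinsuppEquivProdFinsupp.symm.injective.eq_iff
      (a := (κ', u)) (b := (κ, μ)))

/-- The substitution fixes the `X`-part of a monomial, so its matrix is diagonal there and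
`partialCoeff` on the `Y`-part. -/
theorem coeff_prod_sharpY {d : ℕ} (κ κ' μ m : Fin d →₀ ℕ) :
    MvPolynomial.coeff (Finsupp.sumElim κ μ)
      ((Finsupp.sumElim κ' m).prod fun s k => Sum.elim varX sumY s ^ k) =
    if κ' = κ then partialCoeff μ m else 0 := by
  rw [partialCoeff, ← coeff_sumElim_mul_rename, Finsupp.prod_sumElim]
  congr 2
  · rw [MvPolynomial.monomial_eq, map_one, one_mul, Finsupp.prod_sumElim, Finsupp.prod_zero_index,
      mul_one]
    rfl
  · rw [Finsupp.prod, Finsupp.prod, map_prod]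
    refine Finset.prod_congr rfl fun i _ => ?_
    simp [partialSum, sumY, varY]

theorem sharpY_genSeriesB (ψ : NCPolyB0 →ₗ[ℚ] R) (d : ℕ) (M : Bimould R)
    (hM : M d = genSeriesB ψ d) : sharpY M d = genSeriesY (ψ ∘ₗ transform0) d := by
  -- The expansion formula is stated for maps on all of `ℚ⟨B⟩`, since its induction passes through
  -- words starting with `b_0`.
  obtain ⟨F, hF⟩ := ψ.exists_extend
  ext n
  obtain ⟨⟨κ, μ⟩, rfl⟩ := Finsupp.sumFinsuppEquivProdFinsupp.symm.surjective n
  change substPoly _ (M d) (Finsupp.sumElim κ μ) = genSeriesY _ d (Finsupp.sumElim κ μ)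
  rw [hM]
  have h := map_transform_zero_eq_finsum κ μ F
  simp only [genSeriesY, Finsupp.sumElim_inl, Finsupp.sumElim_inr, one_div]
  rw [← hF]
  refine Eq.trans ?_ h.symm
  have hinj : Function.Injective fun m : Fin d →₀ ℕ => Finsupp.sumElim κ m := fun m m' h =>
    congrArg Prod.snd (Finsupp.sumFinsuppEquivProdFinsupp.symm.injective (a₁ := (κ, m))
      (a₂ := (κ, m')) h)
  refine (finsum_eq_finsum_comp hinj _ fun e he => ?_).trans (finsum_congr fun m => ?_)
  · obtain ⟨⟨κ', m⟩, rfl⟩ := Finsupp.sumFinsuppEquivProdFinsupp.symm.surjective e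
    rw [Finsupp.sumFinsuppEquivProdFinsupp_symm_apply, coeff_prod_sharpY, if_neg, zero_smul]
    rintro rfl
    exact he ⟨m, rfl⟩
  · rw [coeff_prod_sharpY, if_pos rfl]
    rfl

end GeneratingSeries

/-! ### Reading off the blocks of a word -/

section Decode

/-- The number of leading `b_0` of a word, and the pairs `(k - 1, m)` of its remaining blocks
`b_k b_0^m`, `k ≥ 1`. -/
def blockDecode : List B → ℕ × List (ℕ × ℕ)
  | [] => (0, [])
  | 0 :: w => ((blockDecode w).1 + 1, (blockDecode w).2)
  | (k + 1) :: w => (0, (k, (blockDecode w).1) :: (blockDecode w).2)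

theorem blockDecode_replicate_append (n : ℕ) (w : List B) :
    blockDecode (List.replicate n 0 ++ w) = ((blockDecode w).1 + n, (blockDecode w).2) := by
  induction n with
  | zero => rfl
  | succ n ih => rw [List.replicate_succ, List.cons_append, blockDecode, ih]; rfl

theorem blockDecode_blockWord {d : ℕ} (κ m : Fin d → ℕ) :
    blockDecode (blockWord κ m) = (0, List.ofFn fun i => (κ i, m i)) := by
  induction d with
  | zero => rfl
  | succ d ih =>
    rw [blockWord_succ, List.singleton_append, blockDecode, blockDecode_replicate_append, ih,
      List.ofFn_succ, Nat.zero_add]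

end Decode

/-! ### Coefficients of a bimould indexed by words -/

section BimouldCoeff

variable {R : Type*}

/-- The coefficient of a bimould at a tuple of pairs of exponents. -/
def tupleCoeff (M : Bimould R) (s : Σ d, Fin d → ℕ × ℕ) : R :=
  M s.1 (Finsupp.equivFunOnFinite.symm (Sum.elim (fun i => (s.2 i).1) fun i => (s.2 i).2))

/-- The coefficient of a bimould at a word of blocks. -/
def bimouldCoeff (M : Bimould R) (w : List B) : R :=
  tupleCoeff M (List.equivSigmaTuple (blockDecode w).2)

theorem bimouldCoeff_blockWord (M : Bimould R) {d : ℕ} (e : Fin d ⊕ Fin d →₀ ℕ) :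
    bimouldCoeff M (blockWord (fun i => e (Sum.inl i)) fun i => e (Sum.inr i)) = M d e := by
  have h : List.equivSigmaTuple (List.ofFn fun i => (e (Sum.inl i), e (Sum.inr i))) =
      ⟨d, fun i => (e (Sum.inl i), e (Sum.inr i))⟩ :=
    List.equivSigmaTuple.apply_symm_apply ⟨d, fun i => (e (Sum.inl i), e (Sum.inr i))⟩
  rw [bimouldCoeff, blockDecode_blockWord, h, tupleCoeff]
  congr 1
  ext (i | i) <;> rfl

end BimouldCoeff

/-! ### Symmetrility against b-symmetrility -/

section Symmetril

variable {R : Type*} [Ring R] [Algebra ℚ R]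

/-- The linear map on `ℚ⟨B⟩⁰` whose values on words are the coefficients of a bimould. -/
def coeffMapB (M : Bimould R) : NCPolyB0 →ₗ[ℚ] R :=
  wordLift (bimouldCoeff M) ∘ₗ NCPolyB0.subtype

theorem genSeriesB_coeffMapB (M : Bimould R) (d : ℕ) : genSeriesB (coeffMapB M) d = M d := by
  funext e
  rw [genSeriesB, coeffMapB, LinearMap.comp_apply]
  exact (wordLift_word _ _).trans (bimouldCoeff_blockWord M e)

theorem genSeriesY_zero {φ : NCPoly Ybi →ₗ[ℚ] R} (h : φ 1 = 1) : genSeriesY φ 0 = 1 := by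
  ext e
  rw [Subsingleton.elim e 0]
  change genSeriesY φ 0 0 = _
  simp only [genSeriesY, wordY, List.ofFn_zero, word_nil, h]
  simp

/-- Each word occurs at some exponent, with a nonzero rational factor that can be cancelled in a
`ℚ`-module. -/
theorem genSeriesY_injective {φ φ' : NCPoly Ybi →ₗ[ℚ] R}
    (h : ∀ d, genSeriesY φ d = genSeriesY φ' d) : φ = φ' := by
  refine ext_word fun w => ?_
  obtain ⟨⟨d, f⟩, rfl⟩ := List.equivSigmaTuple.symm.surjective w
  have hw : wordY (fun i => (f i).1.natPred) (fun i => (f i).2) =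
      word (List.equivSigmaTuple.symm ⟨d, f⟩) := by
    simp only [wordY, PNat.succPNat_natPred]; rfl
  have hd := congrFun (h d) (Finsupp.equivFunOnFinite.symm
    (Sum.elim (fun i => (f i).1.natPred) fun i => (f i).2))
  simp only [genSeriesY, Finsupp.equivFunOnFinite_symm_apply_apply, Sum.elim_inl, Sum.elim_inr,
    hw] at hd
  have hc : (∏ i, (1 / ((f i).2.factorial : ℚ))) ≠ 0 :=
    Finset.prod_ne_zero_iff.2 fun i _ => by positivity
  exact smul_right_injective R hc hd

theorem IsBalancedHom.comp_transform0 {ψ : NCPolyB0 →ₗ[ℚ] R} (h : IsBalancedHom ψ) :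
    IsStuffleHom (ψ ∘ₗ transform0) where
  map_one := by rw [LinearMap.comp_apply, transform0_one, h.map_one]
  map_mul f g := by simp only [LinearMap.comp_apply, transform0_stuffle, h.map_mul]

/-- Multiplicativity descends along the surjective morphism `transform0`. -/
theorem IsStuffleHom.of_comp_transform0 {ψ : NCPolyB0 →ₗ[ℚ] R}
    (h : IsStuffleHom (ψ ∘ₗ transform0)) : IsBalancedHom ψ where
  map_one := by rw [← transform0_one]; exact h.map_one
  map_mul f g := by
    obtain ⟨f, rfl⟩ := transform0_surjective f
    obtain ⟨g, rfl⟩ := transform0_surjective g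
    rw [← transform0_stuffle]
    exact h.map_mul f g

theorem bSymmetril_iff_symmetril_sharpY (M : Bimould R) :
    BSymmetril M ↔ Symmetril (sharpY M) := by
  constructor
  · rintro ⟨ψ, hψ, h0, hM⟩
    exact ⟨ψ ∘ₗ transform0, hψ.comp_transform0, (sharpY_zero M).trans h0,
      fun d hd => sharpY_genSeriesB ψ d M (hM d hd)⟩
  · rintro ⟨φ, hφ, h0, hM⟩
    have key : coeffMapB M ∘ₗ transform0 = φ := by
      refine genSeriesY_injective fun d => ?_
      rw [← sharpY_genSeriesB _ d M (genSeriesB_coeffMapB M d).symm]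
      -- Symmetrility prescribes the series only for `d ≥ 1`; in depth `0` both sides equal `1`
      -- because `φ` is unital.
      rcases Nat.eq_zero_or_pos d with rfl | hd
      · rw [h0, genSeriesY_zero hφ.map_one]
      · exact hM d hd
    rw [← key] at hφ
    exact ⟨coeffMapB M, hφ.of_comp_transform0, (sharpY_zero M).symm.trans h0,
      fun d _ => (genSeriesB_coeffMapB M d).symm⟩

end Symmetril

end

end BalancedQMZV

theorem mainTheorem11 {R : Type*} [Ring R] [Algebra ℚ R] (M : BalancedQMZV.Bimould R) :
    (BalancedQMZV.BSymmetril M ↔ BalancedQMZV.Symmetril (BalancedQMZV.sharpY M)) ∧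
    (BalancedQMZV.TauInvariant M ↔ BalancedQMZV.SwapInvariant (BalancedQMZV.sharpY M)) :=
  ⟨BalancedQMZV.bSymmetril_iff_symmetril_sharpY M,
    BalancedQMZV.tauInvariant_iff_swapInvariant_sharpY M⟩
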